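/- A system $(X,T)$ is a nonempty compact metric space $X$ with a homeomorphism $T:X\to X$; it is minimal if every orbit $\{T^nx:n\in\mathbb Z\}$ is dense, and equicontinuous if the powers $T^n$, $n\in\mathbb Z$, are uniformly equicontinuous. A homomorphism of systems is a continuous surjective equivariant map. Given systems $(X,T)$ and $(Y,S)$, a maximal common equicontinuous factor of them is an equicontinuous system $(Z,R)$ with homomorphisms $\alpha:X\to Z$, $\beta:Y\to Z$ such that for every equicontinuous system $(W,Q)$ with homomorphisms $\phi:X\to W$, $\psi:Y\to W$ there are homomorphisms $\eta_1,\eta_2:Z\to W$ with $\phi=\eta_1\circ\alpha$ and $\psi=\eta_2\circ\beta$. Theorem. Let $(X,T)$ and $(Y,S)$ be minimal systems. They have a maximal common equicontinuous factor of the form $(Z,R)$, where $Z$ is a compact metrizable abelian topological group and $R(z)=z+\theta$ for some $\theta\in Z$. Let $Eq(X,Y)=Z$ be any such factor, with homomorphisms $\alpha:X\to Eq(X,Y)$ and $\beta:Y\to Eq(X,Y)$, and put $\gamma:X\times Y\to Eq(X,Y)$, $\gamma(x,y)=\alpha(x)-\beta(y)$. Then the following are equivalent: 1. $X\perp_{SQ}Y$,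 i.e. $X$ is strongly quasi-disjoint from $Y$: for some realization of $Eq(X,Y)$ as above (with its own $\alpha,\beta,\gamma$) there is a residual set $\Omega\subset Eq(X,Y)$ such that $\gamma^{-1}(z)$ is a minimal subset of $(X\times Y,T\times S)$ for each $z\in\Omega$; 2. there is some $z\in Eq(X,Y)$ such that $\gamma^{-1}(z)$ is a minimal subset of $(X\times Y,T\times S)$; 3. there is a dense $G_\delta$ subset $\Omega\subset Eq(X,Y)$ such that $\gamma^{-1}(z)$ is a minimal subset of $(X\times Y,T\times S)$ for each $z\in\Omega$. Here a minimal subset of a system is a nonempty closed invariant subset in which the orbit of each of its points is dense. -/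

import Mathlib

universe u

/-- The two-sided orbit `{Tⁿ x : n ∈ ℤ}` of a point. -/
def tdsOrbit {X : Type u} [TopologicalSpace X] (T : X ≃ₜ X) (x : X) : Set X :=
  Set.range fun n : ℤ => (T ^ n) x

/-- The system `(X, T)` is minimal: the orbit of every point is dense. -/
def IsMinimalSystem {X : Type u} [TopologicalSpace X] (T : X ≃ₜ X) : Prop :=
  ∀ x : X, Dense (tdsOrbit T x)

/-- `M` is a minimal subset of `(X, T)`: it is nonempty, closed and invariant (`T M = M`), and the
restriction of `T` to `M` is minimal, that is, the orbit of every point of `M` is dense in `M`. -/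
structure IsMinimalSubset {X : Type u} [TopologicalSpace X] (T : X ≃ₜ X) (M : Set X) : Prop where
  nonempty : M.Nonempty
  isClosed : IsClosed M
  invariant : T '' M = M
  subset_closure_orbit : ∀ x ∈ M, M ⊆ closure (tdsOrbit T x)

/-- `π` is a factor map (homomorphism) from `(X, T)` onto `(Y, S)`. -/
structure IsFactorMap {X Y : Type u} [TopologicalSpace X] [TopologicalSpace Y]
    (T : X ≃ₜ X) (S : Y ≃ₜ Y) (π : X → Y) : Prop where
  continuous : Continuous π
  surjective : Function.Surjective π
  equivariant : ∀ x, π (T x) = S (π x)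

/-- The system `(X, T)` is equicontinuous: the powers `Tⁿ`, `n ∈ ℤ`, are uniformly
equicontinuous. -/
def IsEquicontinuousSystem {X : Type u} [MetricSpace X] (T : X ≃ₜ X) : Prop :=
  ∀ ε : ℝ, 0 < ε → ∃ δ : ℝ, 0 < δ ∧
    ∀ x y : X, dist x y < δ → ∀ n : ℤ, dist ((T ^ n) x) ((T ^ n) y) < ε

/-- `(Z, R)` with the homomorphisms `α : X → Z` and `β : Y → Z` is a maximal common equicontinuous
factor of `(X, T)` and `(Y, S)`: it is an equicontinuous common factor, and for every equicontinuous
system `(W, Q)` with homomorphisms `φ : X → W` and `ψ : Y → W` there are homomorphisms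
`η₁, η₂ : Z → W` with `φ = η₁ ∘ α` and `ψ = η₂ ∘ β`. -/
structure IsMaxCommonEquicontinuousFactor {X Y Z : Type u}
    [MetricSpace X] [MetricSpace Y] [MetricSpace Z]
    (T : X ≃ₜ X) (S : Y ≃ₜ Y) (R : Z ≃ₜ Z) (α : X → Z) (β : Y → Z) : Prop where
  equicontinuous : IsEquicontinuousSystem R
  left : IsFactorMap T R α
  right : IsFactorMap S R β
  maximal : ∀ (W : Type u) [MetricSpace W] [CompactSpace W] (Q : W ≃ₜ W) (φ : X → W) (ψ : Y → W),
    IsEquicontinuousSystem Q → IsFactorMap T Q φ → IsFactorMap S Q ψ →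
      ∃ η₁ η₂ : Z → W, IsFactorMap R Q η₁ ∧ IsFactorMap R Q η₂ ∧ φ = η₁ ∘ α ∧ ψ = η₂ ∘ β

/-- `Eq(X, Y)` in the form in which the difference `α(x) - β(y)` makes sense: the maximal common
equicontinuous factor of `(X, T)` and `(Y, S)`, realized as the rotation `z ↦ z + θ` of a compact
metric abelian group `Z`, together with the homomorphisms `α` and `β`. -/
def IsEqRotation {X Y Z : Type u} [MetricSpace X] [MetricSpace Y] [MetricSpace Z]
    [AddCommGroup Z] [IsTopologicalAddGroup Z]
    (T : X ≃ₜ X) (S : Y ≃ₜ Y) (θ : Z) (α : X → Z) (β : Y → Z) : Prop :=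
  IsMaxCommonEquicontinuousFactor T S (Homeomorph.addRight θ) α β

/-- The map `γ(x, y) = α(x) - β(y)`. -/
def gammaMap {X Y Z : Type u} [AddCommGroup Z] (α : X → Z) (β : Y → Z) : X × Y → Z :=
  fun p => α p.1 - β p.2

/-- The fibre `γ⁻¹(z)` is a minimal subset of `(X × Y, T × S)`. -/
def IsMinimalFibre {X Y Z : Type u} [TopologicalSpace X] [TopologicalSpace Y] [AddCommGroup Z]
    (T : X ≃ₜ X) (S : Y ≃ₜ Y) (α : X → Z) (β : Y → Z) (z : Z) : Prop :=
  IsMinimalSubset (T.prodCongr S) (gammaMap α β ⁻¹' {z})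

/-- Strong quasi-disjointness `X ⊥_SQ Y`: there is a residual set `Ω ⊆ Eq(X, Y)` such that
`γ⁻¹(z)` is a minimal subset of `X × Y` for each `z ∈ Ω`. The realization of `Eq(X, Y)` as a group
rotation is unique up to isomorphism, and `γ` up to a translation, so that it does not matter which
one is used. -/
def StronglyQuasiDisjoint {X Y : Type u} [MetricSpace X] [MetricSpace Y]
    (T : X ≃ₜ X) (S : Y ≃ₜ Y) : Prop :=
  ∃ (Z : Type u) (_ : MetricSpace Z) (_ : CompactSpace Z) (_ : AddCommGroup Z)
    (_ : IsTopologicalAddGroup Z) (θ : Z) (α : X → Z) (β : Y → Z),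
    IsEqRotation T S θ α β ∧
      ∃ Ω : Set Z, Ω ∈ residual Z ∧ ∀ z ∈ Ω, IsMinimalFibre T S α β z

/-! Existence: fix base points `x`, `y`. An equicontinuous common factor `(W, Q)` gives the seminorm
`displacement Q` on `ℤ`, which by uniform equicontinuity is controlled by both orbits. Controlled
seminorms extend to continuous functions on `X`, and `C(X, ℝ)` is separable, so countably many of
them, combined into one convergent sum, dominate all the others (`exists_finest_isControlledBy`).
Completing `ℤ` for this finest seminorm gives `Z`, with `θ` the image of `1`; the orbit maps `n ↦ n
• θ` extend to `α` and `β`, and domination extends `n ↦ (Q ^ n) (φ x)` to `Z`.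

Equivalence: the set of `z` with minimal fibre is always a `Gδ`, because failure of minimality at a
given scale is a closed condition on `z`. It is invariant under translation by multiples of `θ`,
hence dense once nonempty. Two realizations have the same partition of `X × Y` into fibres of `γ`,
so the choice made in strong quasi-disjointness is harmless. -/

open Set Filter Topology

/-! ### Integer powers of homeomorphisms and rotations. -/

section Iterates

variable {X Y : Type u} [TopologicalSpace X] [TopologicalSpace Y]

theorem homeomorph_zpow_add_apply (T : X ≃ₜ X) (m n : ℤ) (x : X) :
    (T ^ (m + n)) x = (T ^ m) ((T ^ n) x) := by
  rw [zpow_add, Homeomorph.mul_apply]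

theorem semiconj_zpow {T : X ≃ₜ X} {S : Y ≃ₜ Y} {π : X → Y} (h : ∀ x, π (T x) = S (π x))
    (n : ℤ) (x : X) : π ((T ^ n) x) = (S ^ n) (π x) := by
  induction n with
  | zero => simp
  | succ n ih =>
    rw [add_comm, homeomorph_zpow_add_apply, homeomorph_zpow_add_apply, zpow_one, zpow_one, h, ih]
  | pred n ih =>
    have hT := homeomorph_zpow_add_apply T 1 (-(n : ℤ) - 1) x
    have hS := homeomorph_zpow_add_apply S 1 (-(n : ℤ) - 1) (π x)
    rw [show (1 : ℤ) + (-(n : ℤ) - 1) = -n by ring, zpow_one] at hT hS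
    rw [hT, hS, h] at ih
    exact S.injective ih

theorem addRight_zpow_apply {Z : Type u} [TopologicalSpace Z] [AddCommGroup Z]
    [IsTopologicalAddGroup Z] (θ : Z) (n : ℤ) (z : Z) :
    (Homeomorph.addRight θ ^ n) z = z + n • θ := by
  induction n with
  | zero => simp
  | succ n ih =>
    rw [add_comm, homeomorph_zpow_add_apply, ih, zpow_one, Homeomorph.coe_addRight, add_zsmul,
      one_zsmul]
    exact (add_right_comm z ((n : ℤ) • θ) θ).trans (add_assoc _ _ _)
  | pred n ih =>
    have h := homeomorph_zpow_add_apply (Homeomorph.addRight θ) 1 (-(n : ℤ) - 1) z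
    rw [show (1 : ℤ) + (-(n : ℤ) - 1) = -n by ring, zpow_one, ih, Homeomorph.coe_addRight] at h
    rw [sub_zsmul, one_zsmul, ← add_sub_cancel_right ((Homeomorph.addRight θ ^ (-(n : ℤ) - 1)) z) θ]
    exact (congrArg (· - θ) h.symm).trans (by simp [sub_eq_add_neg, add_assoc])

theorem IsMinimalSubset.image {R H : X ≃ₜ X} (hRH : ∀ x, H (R x) = R (H x)) {M : Set X}
    (hM : IsMinimalSubset R M) : IsMinimalSubset R (H '' M) where
  nonempty := hM.nonempty.image H
  isClosed := H.isClosedMap _ hM.isClosed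
  invariant := by
    conv_rhs => rw [← hM.invariant]
    simp only [image_image, hRH]
  subset_closure_orbit := by
    rintro _ ⟨x, hx, rfl⟩
    have h : tdsOrbit R (H x) = H '' tdsOrbit R x := by
      rw [tdsOrbit, tdsOrbit, ← range_comp]
      exact congrArg range (funext fun n => (semiconj_zpow hRH n x).symm)
    rw [h, ← H.image_closure]
    exact image_mono (hM.subset_closure_orbit x hx)

end Iterates

/-! ### The minimal fibres of an invariant map form a `Gδ`. -/

section Fibres

theorem isMinimalSubset_fibre_iff {P Z : Type u} [MetricSpace P] [TopologicalSpace Z]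
    [T1Space Z] {R : P ≃ₜ P} {g : P → Z} (hg : Continuous g) (hs : Function.Surjective g)
    (hinv : ∀ p, g (R p) = g p) (z : Z) :
    IsMinimalSubset R (g ⁻¹' {z}) ↔
      ∀ k : ℕ, ∀ p q, g p = z → g q = z → ∃ n : ℤ, dist ((R ^ n) p) q < 1 / (k + 1) := by
  constructor
  · intro h k p q hp hq
    obtain ⟨_, ⟨n, rfl⟩, hn⟩ := Metric.mem_closure_iff.1 (h.subset_closure_orbit p hp hq)
      (1 / (k + 1)) Nat.one_div_pos_of_nat
    exact ⟨n, by rwa [dist_comm]⟩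
  · intro h
    refine ⟨hs z, isClosed_singleton.preimage hg, ?_, ?_⟩
    · ext p
      rw [R.image_eq_preimage_symm]
      have := hinv (R.symm p)
      rw [R.apply_symm_apply] at this
      simp [this]
    · intro p hp q hq
      refine Metric.mem_closure_iff.2 fun ε hε => ?_
      obtain ⟨k, hk⟩ := exists_nat_one_div_lt hε
      obtain ⟨n, hn⟩ := h k p q hp hq
      exact ⟨_, ⟨n, rfl⟩, by rw [dist_comm]; exact hn.trans hk⟩

/-- For each `k`, the pairs in a common fibre for which no iterate of the first point comes within
`1 / (k + 1)` of the second form a compact set. Its image in `Z` is closed, and the good `z` are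
those avoiding all these images. -/
theorem isGδ_setOf_isMinimalSubset_fibre {P Z : Type u} [MetricSpace P] [CompactSpace P]
    [TopologicalSpace Z] [T2Space Z] {R : P ≃ₜ P} {g : P → Z} (hg : Continuous g)
    (hs : Function.Surjective g) (hinv : ∀ p, g (R p) = g p) :
    IsGδ {z | IsMinimalSubset R (g ⁻¹' {z})} := by
  have key : {z | IsMinimalSubset R (g ⁻¹' {z})} = ⋂ k : ℕ,
      ((fun w : P × P => g w.1) ''
        {w | g w.1 = g w.2 ∧ ∀ n : ℤ, 1 / ((k : ℝ) + 1) ≤ dist ((R ^ n) w.1) w.2})ᶜ := by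
    ext z
    rw [mem_ofPred_eq, isMinimalSubset_fibre_iff hg hs hinv, mem_iInter]
    refine forall_congr' fun k => ?_
    constructor
    · rintro h ⟨⟨p, q⟩, ⟨hpq, hn⟩, hz⟩
      obtain ⟨n, hlt⟩ := h p q hz (hpq ▸ hz)
      exact absurd (hn n) (not_le.2 hlt)
    · intro h p q hp hq
      by_contra! hn
      exact h ⟨(p, q), ⟨hp.trans hq.symm, hn⟩, hp⟩
  rw [key]
  refine IsGδ.iInter fun k => IsOpen.isGδ (isOpen_compl_iff.2 (IsCompact.isClosed ?_))
  refine IsCompact.image (IsClosed.isCompact ?_) (hg.comp continuous_fst)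
  rw [ofPred_and, ofPred_forall]
  refine (isClosed_eq (hg.comp continuous_fst) (hg.comp continuous_snd)).inter ?_
  exact isClosed_iInter fun n => isClosed_le continuous_const
    (((R ^ n).continuous.comp continuous_fst).dist continuous_snd)

end Fibres

/-! ### Translating fibres of `γ` and comparing realizations. -/

section Rotations

theorem surjective_gammaMap {X Y Z : Type u} [AddCommGroup Z] {α : X → Z} {β : Y → Z} [Nonempty Y] (hα : Function.Surjective α) :
    Function.Surjective (gammaMap α β) := by
  intro z
  obtain ⟨y⟩ := ‹Nonempty Y›
  obtain ⟨x, hx⟩ := hα (z + β y)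
  exact ⟨(x, y), by simp [gammaMap, hx]⟩

variable {X Y Z : Type u} [MetricSpace X] [MetricSpace Y] [MetricSpace Z] [AddCommGroup Z]
  [IsTopologicalAddGroup Z] {T : X ≃ₜ X} {S : Y ≃ₜ Y} {θ : Z} {α : X → Z} {β : Y → Z}

theorem IsFactorMap.apply_zpow_rotation (h : IsFactorMap T (Homeomorph.addRight θ) α) (n : ℤ)
    (x : X) : α ((T ^ n) x) = α x + n • θ := by
  rw [semiconj_zpow h.equivariant, addRight_zpow_apply]

theorem IsFactorMap.denseRange_zsmul [Nonempty X] (hT : IsMinimalSystem T)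
    (h : IsFactorMap T (Homeomorph.addRight θ) α) : DenseRange fun n : ℤ => n • θ := by
  obtain ⟨x⟩ := ‹Nonempty X›
  have h1 : DenseRange fun n : ℤ => (T ^ n) x := hT x
  have h2 := (Homeomorph.addLeft (-α x)).surjective.denseRange.comp
    (h.surjective.denseRange.comp h1 h.continuous) (Homeomorph.addLeft (-α x)).continuous
  convert h2 using 2 with n
  simp [h.apply_zpow_rotation]

theorem continuous_gammaMap (hα : Continuous α) (hβ : Continuous β) :
    Continuous (gammaMap α β) :=
  (hα.comp continuous_fst).sub (hβ.comp continuous_snd)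

theorem gammaMap_prodCongr (hα : IsFactorMap T (Homeomorph.addRight θ) α)
    (hβ : IsFactorMap S (Homeomorph.addRight θ) β) (p : X × Y) :
    gammaMap α β (T.prodCongr S p) = gammaMap α β p := by
  simp [gammaMap, hα.equivariant, hβ.equivariant]

/-- The homeomorphism `id × S ^ n` commutes with `T × S` and shifts `γ` by `-n • θ`, so it carries
one fibre onto the other. -/
theorem IsMinimalFibre.sub_zsmul (hβ : IsFactorMap S (Homeomorph.addRight θ) β) {z : Z}
    (hz : IsMinimalFibre T S α β z) (n : ℤ) : IsMinimalFibre T S α β (z - n • θ) := by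
  set H : X × Y ≃ₜ X × Y := (Homeomorph.refl X).prodCongr (S ^ n)
  have hH : ∀ p, gammaMap α β (H p) = gammaMap α β p - n • θ := fun p => by
    simp [H, gammaMap, hβ.apply_zpow_rotation, sub_sub]
  have himage : H '' (gammaMap α β ⁻¹' {z}) = gammaMap α β ⁻¹' {z - n • θ} := by
    ext p
    have := hH (H.symm p)
    rw [H.apply_symm_apply] at this
    rw [H.image_eq_preimage_symm]
    simp [this]
  rw [IsMinimalFibre, ← himage]
  refine IsMinimalSubset.image (R := T.prodCongr S) (H := H) (fun p => Prod.ext rfl ?_) hz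
  exact semiconj_zpow (T := S) (S := S) (π := S) (fun _ => rfl) n p.2 |>.symm

theorem dense_setOf_isMinimalFibre [Nonempty X] (hT : IsMinimalSystem T)
    (hα : IsFactorMap T (Homeomorph.addRight θ) α) (hβ : IsFactorMap S (Homeomorph.addRight θ) β)
    {z : Z} (hz : IsMinimalFibre T S α β z) : Dense {w | IsMinimalFibre T S α β w} := by
  have h : DenseRange fun n : ℤ => z - n • θ :=
    (Homeomorph.subLeft z).surjective.denseRange.comp (hα.denseRange_zsmul hT)
      (Homeomorph.subLeft z).continuous
  refine Dense.mono ?_ h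
  rintro _ ⟨n, rfl⟩
  exact hz.sub_zsmul hβ n

variable {Z' : Type u} [MetricSpace Z'] [AddCommGroup Z'] [IsTopologicalAddGroup Z'] {θ' : Z'}

/-- For `b = n • θ` both sides are computed by moving `n` steps along the rotations, and the
contributions `n • θ'` cancel; density of these `b` and continuity give the rest. -/
theorem IsFactorMap.rotation_sub {f g : Z → Z'} (hθ : DenseRange fun n : ℤ => n • θ)
    (hf : IsFactorMap (Homeomorph.addRight θ) (Homeomorph.addRight θ') f)
    (hg : IsFactorMap (Homeomorph.addRight θ) (Homeomorph.addRight θ') g) (a b : Z) :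
    f a - g b = f (a - b) - g 0 := by
  refine hθ.induction_on b (isClosed_eq (continuous_const.sub hg.continuous)
    ((hf.continuous.comp (continuous_const.sub continuous_id)).sub continuous_const)) fun n => ?_
  have h1 := hf.apply_zpow_rotation n (a - n • θ)
  have h2 := hg.apply_zpow_rotation n 0
  rw [addRight_zpow_apply] at h1 h2
  rw [sub_add_cancel] at h1
  rw [zero_add] at h2
  rw [h1, h2]
  abel

/-- Maximality supplies possibly different maps `η₁`, `η₂`, but `rotation_sub` shows that the
difference still depends on `α x - β y` alone. -/
theorem IsEqRotation.exists_gammaMap_eq [CompactSpace Z'] [Nonempty X] (hT : IsMinimalSystem T)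
    {α' : X → Z'} {β' : Y → Z'} (h : IsEqRotation T S θ α β)
    (h' : IsEqRotation T S θ' α' β') :
    ∃ F : Z → Z', ∀ p, gammaMap α' β' p = F (gammaMap α β p) := by
  obtain ⟨η₁, η₂, h₁, h₂, rfl, rfl⟩ :=
    h.maximal Z' (Homeomorph.addRight θ') α' β' h'.equicontinuous h'.left h'.right
  exact ⟨fun z => η₁ z - η₂ 0, fun p => h₁.rotation_sub (h.left.denseRange_zsmul hT) h₂ _ _⟩

theorem IsEqRotation.exists_isMinimalFibre [CompactSpace Z] [CompactSpace Z'] [Nonempty X]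
    [Nonempty Y] (hT : IsMinimalSystem T) {α' : X → Z'} {β' : Y → Z'}
    (h : IsEqRotation T S θ α β) (h' : IsEqRotation T S θ' α' β') {z' : Z'}
    (hz' : IsMinimalFibre T S α' β' z') : ∃ z, IsMinimalFibre T S α β z := by
  obtain ⟨F, hF⟩ := h.exists_gammaMap_eq hT h'
  obtain ⟨G, hG⟩ := h'.exists_gammaMap_eq hT h
  refine ⟨G z', ?_⟩
  -- Each of the two maps factors through the other, so they have the same fibres.
  have : gammaMap α β ⁻¹' {G z'} = gammaMap α' β' ⁻¹' {z'} := by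
    ext p
    obtain ⟨q, rfl⟩ := surjective_gammaMap (β := β') h'.left.surjective z'
    simp only [mem_preimage, mem_singleton_iff]
    rw [← hG q]
    exact ⟨fun hpq => by rw [hF, hF, hpq], fun hpq => by rw [hG, hG, hpq]⟩
  rw [IsMinimalFibre, this]
  exact hz'

end Rotations

/-! ### Construction of `Eq(X, Y)` from seminorms on `ℤ`. -/

section Existence

theorem exists_continuous_extension {ι X Z : Type*} [PseudoMetricSpace X] [MetricSpace Z]
    [CompleteSpace Z] {u : ι → X} {v : ι → Z} (hu : DenseRange u)
    (h : ∀ ε > 0, ∃ δ > 0, ∀ i j, dist (u i) (u j) < δ → dist (v i) (v j) < ε) :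
    ∃ f : X → Z, Continuous f ∧ ∀ i, f (u i) = v i := by
  -- With the distance pulled back along `u`, the hypothesis says that `v` is uniformly continuous.
  let : PseudoMetricSpace ι := PseudoMetricSpace.induced u inferInstance
  have hi : IsUniformInducing u := ⟨rfl⟩
  have hv : UniformContinuous v := Metric.uniformContinuous_iff.2 fun ε hε => by
    obtain ⟨δ, hδ, hd⟩ := h ε hε
    exact ⟨δ, hδ, fun {i j} hij => hd i j hij⟩
  exact ⟨_, (uniformContinuous_uniformly_extend hi hu hv).continuous,
    uniformly_extend_of_ind hi hu hv⟩

/-- The seminorm `N` of `n - m` is small whenever `u n` and `u m` are close to each other. -/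
def IsControlledBy {X : Type*} [PseudoMetricSpace X] (u : ℤ → X) (N : AddGroupSeminorm ℤ) : Prop :=
  ∀ ε > 0, ∃ δ > 0, ∀ m n, dist (u m) (u n) < δ → N (m - n) < ε

theorem isControlledBy_iff_tendsto {X : Type*} [PseudoMetricSpace X] {u : ℤ → X}
    {N : AddGroupSeminorm ℤ} : IsControlledBy u N ↔
      Tendsto (fun p : ℤ × ℤ => N (p.1 - p.2))
        (comap (fun p : ℤ × ℤ => dist (u p.1) (u p.2)) (𝓝 0)) (𝓝 0) := by
  rw [(Metric.nhds_basis_ball.comap _).tendsto_iff Metric.nhds_basis_ball]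
  simp [IsControlledBy, abs_of_nonneg]

theorem IsControlledBy.exists_extension {X : Type*} [PseudoMetricSpace X] {u : ℤ → X}
    (hu : DenseRange u) {N : AddGroupSeminorm ℤ} (hN : IsControlledBy u N) :
    ∃ f : C(X, ℝ), ∀ n, f (u n) = N n := by
  obtain ⟨f, hf, hfu⟩ := exists_continuous_extension (v := fun n => N n) hu fun ε hε => by
    obtain ⟨δ, hδ, h⟩ := hN ε hε
    exact ⟨δ, hδ, fun m n hmn => (abs_sub_map_le_sub N m n).trans_lt (h m n hmn)⟩
  exact ⟨⟨f, hf⟩, hfu⟩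

theorem summable_two_pow_mul_min (N : ℕ → AddGroupSeminorm ℤ) (n : ℤ) :
    Summable fun i => (1 / 2 : ℝ) ^ i * min (N i n) 1 :=
  summable_geometric_two.of_nonneg_of_le
    (fun i => mul_nonneg (by positivity) (le_min (apply_nonneg _ _) zero_le_one))
    (fun i => mul_le_of_le_one_right (by positivity) (min_le_right _ _))

/-- The sum `∑ 2⁻ⁱ min(Nᵢ, 1)` of a sequence of seminorms. -/
noncomputable def truncatedSum (N : ℕ → AddGroupSeminorm ℤ) : AddGroupSeminorm ℤ :=
  have hs := summable_two_pow_mul_min N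
  { toFun := fun n => ∑' i, (1 / 2 : ℝ) ^ i * min (N i n) 1
    map_zero' := by simp
    add_le' := fun m n => by
      rw [← (hs m).tsum_add (hs n)]
      refine (hs _).tsum_le_tsum (fun i => ?_) ((hs m).add (hs n))
      rw [← mul_add]
      refine mul_le_mul_of_nonneg_left ?_ (by positivity)
      have h := map_add_le_add (N i) m n
      have hm := apply_nonneg (N i) m
      have hn := apply_nonneg (N i) n
      grind
    neg' := fun n => by simp [map_neg_eq_map] }

theorem le_truncatedSum (N : ℕ → AddGroupSeminorm ℤ) (i : ℕ) (n : ℤ) :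
    (1 / 2 : ℝ) ^ i * min (N i n) 1 ≤ truncatedSum N n :=
  (summable_two_pow_mul_min N n).le_tsum i fun j _ =>
    mul_nonneg (by positivity) (le_min (apply_nonneg _ _) zero_le_one)

theorem IsControlledBy.truncatedSum {X : Type*} [PseudoMetricSpace X] {u : ℤ → X}
    {N : ℕ → AddGroupSeminorm ℤ} (hN : ∀ i, IsControlledBy u (N i)) :
    IsControlledBy u (truncatedSum N) := by
  rw [isControlledBy_iff_tendsto]
  have h := tendsto_tsum_of_dominated_convergence
    (𝓕 := comap (fun p : ℤ × ℤ => dist (u p.1) (u p.2)) (𝓝 0))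
    (f := fun p i => (1 / 2 : ℝ) ^ i * min (N i (p.1 - p.2)) 1) (g := fun _ => 0)
    summable_geometric_two
    (fun i => by
      have := ((isControlledBy_iff_tendsto.1 (hN i)).min
        (tendsto_const_nhds (x := (1 : ℝ)))).const_mul ((1 / 2 : ℝ) ^ i)
      rwa [min_eq_left zero_le_one, mul_zero] at this)
    (Eventually.of_forall fun p i => by
      rw [Real.norm_of_nonneg
        (mul_nonneg (by positivity) (le_min (apply_nonneg _ _) zero_le_one))]
      exact mul_le_of_le_one_right (by positivity) (min_le_right _ _))
  rw [tsum_zero] at h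
  exact h

/-- Among the seminorms controlled by two sequences, the first of which is dense in a compact space,
there is one that is finer than all others. -/
theorem exists_finest_isControlledBy {X Y : Type*} [MetricSpace X] [CompactSpace X]
    [PseudoMetricSpace Y] {u : ℤ → X} (hu : DenseRange u) (v : ℤ → Y) :
    ∃ N₀ : AddGroupSeminorm ℤ, IsControlledBy u N₀ ∧ IsControlledBy v N₀ ∧
      ∀ N, IsControlledBy u N → IsControlledBy v N →
        ∀ ε > 0, ∃ δ > 0, ∀ n, N₀ n < δ → N n < ε := by
  let I := {N : AddGroupSeminorm ℤ // IsControlledBy u N ∧ IsControlledBy v N}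
  choose F hF using fun N : I => N.2.1.exists_extension hu
  have : Nonempty I := ⟨⟨0, fun ε hε => ⟨1, one_pos, fun _ _ _ => hε⟩,
    fun ε hε => ⟨1, one_pos, fun _ _ _ => hε⟩⟩⟩
  -- Separability of `C(X, ℝ)` gives a sequence of controlled seminorms whose extensions are
  -- sup-norm dense among all the extensions.
  choose N hN using fun i => (TopologicalSpace.denseSeq (range F) i).2
  refine ⟨truncatedSum fun i => (N i).1, .truncatedSum fun i => (N i).2.1,
    .truncatedSum fun i => (N i).2.2, fun M hMu hMv ε hε => ?_⟩
  obtain ⟨i, hi⟩ := (TopologicalSpace.denseRange_denseSeq (range F)).exists_dist_lt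
    ⟨F ⟨M, hMu, hMv⟩, mem_range_self _⟩ (half_pos hε)
  rw [Subtype.dist_eq, ← hN] at hi
  -- Below this threshold the `i`-th term of the sum forces `N i n < ε / 2`; the sup-norm
  -- approximation of `M` by `N i` costs the other `ε / 2`.
  refine ⟨(1 / 2) ^ i * min (ε / 2) 1, by positivity, fun n hn => ?_⟩
  have h1 := (le_truncatedSum (fun i => (N i).1) i n).trans_lt hn
  have h2 : min ((N i).1 n) 1 < min (ε / 2) 1 := lt_of_mul_lt_mul_left h1 (by positivity)
  have h3 : (N i).1 n < ε / 2 := by grind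
  have h4 := (ContinuousMap.dist_apply_le_dist (u n)).trans_lt hi
  rw [hF, hF, Real.dist_eq] at h4
  have h5 := (abs_lt.1 h4).2
  dsimp only at h5
  linarith

/-- The completion of an abelian group with respect to a seminorm. -/
theorem AddGroupSeminorm.exists_completion {A : Type u} [AddCommGroup A]
    (p : AddGroupSeminorm A) : ∃ (Z : Type u) (_ : NormedAddCommGroup Z) (_ : CompleteSpace Z)
      (f : A →+ Z), DenseRange f ∧ ∀ a, ‖f a‖ = p a := by
  let : SeminormedAddCommGroup A := p.toSeminormedAddCommGroup
  exact ⟨UniformSpace.Completion A, inferInstance, inferInstance,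
    UniformSpace.Completion.toCompl, UniformSpace.Completion.denseRange_coe,
    fun a => UniformSpace.Completion.norm_coe a⟩

theorem AddGroupSeminorm.exists_completion_int (N : AddGroupSeminorm ℤ) :
    ∃ (Z : Type u) (_ : NormedAddCommGroup Z) (_ : CompleteSpace Z) (θ : Z),
      (DenseRange fun n : ℤ => n • θ) ∧ ∀ n : ℤ, ‖n • θ‖ = N n := by
  obtain ⟨Z, i₁, i₂, f, hf, hn⟩ :=
    (N.comp (AddEquiv.ulift : ULift.{u} ℤ ≃+ ℤ).toAddMonoidHom).exists_completion
  have h : ∀ n : ℤ, n • f ⟨1⟩ = f ⟨n⟩ := fun n => by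
    rw [← map_zsmul]
    exact congrArg f (ULift.ext _ _ (by simp))
  refine ⟨Z, i₁, i₂, f ⟨1⟩, ?_, fun n => by rw [h, hn]; rfl⟩
  simp only [h]
  exact hf.comp ULift.up_surjective.denseRange continuous_of_discreteTopology

theorem isEquicontinuousSystem_addRight {Z : Type u} [NormedAddCommGroup Z] (θ : Z) :
    IsEquicontinuousSystem (Homeomorph.addRight θ) := fun ε hε =>
  ⟨ε, hε, fun x y h n => by simpa only [addRight_zpow_apply, dist_add_right] using h⟩

theorem bddAbove_range_dist_zpow {W : Type u} [MetricSpace W] [CompactSpace W] (Q : W ≃ₜ W)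
    (n : ℤ) : BddAbove (range fun w => dist ((Q ^ n) w) w) :=
  ⟨Metric.diam (univ : Set W), by
    rintro _ ⟨w, rfl⟩
    exact Metric.dist_le_diam_of_mem isCompact_univ.isBounded trivial trivial⟩

/-- The seminorm `n ↦ sup_w d(Qⁿ w, w)` on `ℤ`. -/
noncomputable def displacement {W : Type u} [MetricSpace W] [CompactSpace W] (Q : W ≃ₜ W) :
    AddGroupSeminorm ℤ :=
  have hb := bddAbove_range_dist_zpow Q
  have h0 : ∀ n : ℤ, 0 ≤ ⨆ w, dist ((Q ^ n) w) w := fun n => Real.iSup_nonneg fun _ => dist_nonneg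
  have hneg : ∀ n : ℤ, ⨆ w, dist ((Q ^ (-n)) w) w ≤ ⨆ w, dist ((Q ^ n) w) w := fun n =>
    Real.iSup_le (fun w => by
      refine le_trans (le_of_eq ?_) (le_ciSup (hb n) ((Q ^ (-n)) w))
      rw [← homeomorph_zpow_add_apply, add_neg_cancel, zpow_zero, Homeomorph.one_apply, dist_comm])
      (h0 n)
  { toFun := fun n => ⨆ w, dist ((Q ^ n) w) w
    map_zero' := by simp
    add_le' := fun m n => Real.iSup_le (fun w => by
      rw [homeomorph_zpow_add_apply]
      exact (dist_triangle _ ((Q ^ n) w) _).trans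
        (add_le_add (le_ciSup (hb m) ((Q ^ n) w)) (le_ciSup (hb n) w))) (add_nonneg (h0 m) (h0 n))
    neg' := fun n => le_antisymm (hneg n) (by simpa using hneg (-n)) }

/-! ### Displacement seminorms of equicontinuous factors. -/

section Displacement

variable {W : Type u} [MetricSpace W] [CompactSpace W] {Q : W ≃ₜ W}

theorem dist_zpow_le_displacement (n : ℤ) (w : W) : dist ((Q ^ n) w) w ≤ displacement Q n :=
  le_ciSup (bddAbove_range_dist_zpow Q n) w

theorem dist_zpow_zpow_le_displacement (m n : ℤ) (w : W) :
    dist ((Q ^ m) w) ((Q ^ n) w) ≤ displacement Q (m - n) := by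
  have h := dist_zpow_le_displacement (Q := Q) (m - n) ((Q ^ n) w)
  rwa [← homeomorph_zpow_add_apply, sub_add_cancel] at h

/-- If `(T ^ m) x` and `(T ^ n) x` are close, so are their images under `φ`, and equicontinuity
keeps them close under all powers of `Q`. This bounds the displacement of `Q ^ (m - n)` along a
dense orbit, hence everywhere. -/
theorem IsFactorMap.isControlledBy_displacement {X : Type u} [MetricSpace X] [CompactSpace X]
    {T : X ≃ₜ X} (hT : IsMinimalSystem T) {φ : X → W} (hφ : IsFactorMap T Q φ)
    (hQ : IsEquicontinuousSystem Q) (x : X) :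
    IsControlledBy (fun n => (T ^ n) x) (displacement Q) := by
  intro ε hε
  obtain ⟨δ', hδ', hQ'⟩ := hQ (ε / 2) (half_pos hε)
  obtain ⟨δ, hδ, hφ'⟩ := Metric.uniformContinuous_iff.1
    (CompactSpace.uniformContinuous_of_continuous hφ.continuous) δ' hδ'
  refine ⟨δ, hδ, fun m n hmn => ?_⟩
  have h := hφ' hmn
  rw [semiconj_zpow hφ.equivariant, semiconj_zpow hφ.equivariant] at h
  have hd : DenseRange fun k : ℤ => φ ((T ^ k) x) :=
    hφ.surjective.denseRange.comp (hT x) hφ.continuous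
  have hle : displacement Q (m - n) ≤ ε / 2 := by
    refine Real.iSup_le (fun w => ?_) (half_pos hε).le
    refine hd.induction_on w
      (isClosed_le ((Q ^ (m - n)).continuous.dist continuous_id) continuous_const) fun k => ?_
    -- Applying `Q ^ (k - n)` turns the pair into `Q ^ (m - n)` of the `k`-th orbit point and that
    -- orbit point itself.
    have hk := hQ' _ _ h (k - n)
    rw [← homeomorph_zpow_add_apply, ← homeomorph_zpow_add_apply] at hk
    rw [semiconj_zpow hφ.equivariant, ← homeomorph_zpow_add_apply]
    rw [show k - n + m = m - n + k by ring, show k - n + n = k by ring] at hk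
    exact hk.le
  linarith

end Displacement

/-! ### The completion as a common factor, and its maximality. -/

theorem IsControlledBy.exists_isFactorMap {X Z : Type u} [MetricSpace X] [CompactSpace X]
    [NormedAddCommGroup Z] [CompleteSpace Z] {T : X ≃ₜ X} (hT : IsMinimalSystem T) {x : X} {θ : Z}
    (hθ : DenseRange fun n : ℤ => n • θ) {N : AddGroupSeminorm ℤ} (hn : ∀ n : ℤ, ‖n • θ‖ = N n)
    (h : IsControlledBy (fun n => (T ^ n) x) N) :
    ∃ α : X → Z, IsFactorMap T (Homeomorph.addRight θ) α ∧ ∀ n : ℤ, α ((T ^ n) x) = n • θ := by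
  have hd : DenseRange fun n : ℤ => (T ^ n) x := hT x
  obtain ⟨α, hα, hαn⟩ := exists_continuous_extension (v := fun n : ℤ => n • θ) hd fun ε hε => by
    obtain ⟨δ, hδ, h⟩ := h ε hε
    refine ⟨δ, hδ, fun m n hmn => ?_⟩
    rw [dist_eq_norm, ← sub_smul, hn]
    exact h m n hmn
  refine ⟨α, ⟨hα, ?_, fun y => ?_⟩, hαn⟩
  -- The range is compact, hence closed, and contains the dense set of multiples of `θ`.
  · rw [← range_eq_univ, ← (isCompact_range hα).isClosed.closure_eq, ← univ_subset_iff,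
      ← hθ.closure_range]
    exact closure_mono (range_subset_iff.2 fun n => ⟨_, hαn n⟩)
  · refine hd.induction_on y (isClosed_eq (hα.comp T.continuous)
      ((Homeomorph.addRight θ).continuous.comp hα)) fun n => ?_
    have := hαn (1 + n)
    rw [homeomorph_zpow_add_apply, zpow_one] at this
    rw [this, hαn, Homeomorph.coe_addRight, add_comm, add_zsmul, one_zsmul]

/-- The domination hypothesis makes `n • θ ↦ (Q ^ n) (φ x)` uniformly continuous. Its extension
composed with `α` agrees with `φ` on the dense orbit of `x`; surjectivity and equivariance then
descend from `φ`. -/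
theorem IsFactorMap.exists_factorization {X Z W : Type u} [MetricSpace X]
    [NormedAddCommGroup Z] [MetricSpace W] [CompactSpace W] {T : X ≃ₜ X} (hT : IsMinimalSystem T)
    {x : X} {θ : Z} (hθ : DenseRange fun n : ℤ => n • θ) {α : X → Z}
    (hα : IsFactorMap T (Homeomorph.addRight θ) α) (hαn : ∀ n : ℤ, α ((T ^ n) x) = n • θ)
    {Q : W ≃ₜ W} {φ : X → W} (hφ : IsFactorMap T Q φ)
    (h : ∀ ε > 0, ∃ δ > 0, ∀ n : ℤ, ‖n • θ‖ < δ → displacement Q n < ε) :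
    ∃ η : Z → W, IsFactorMap (Homeomorph.addRight θ) Q η ∧ φ = η ∘ α := by
  obtain ⟨η, hη, hηn⟩ := exists_continuous_extension (v := fun n : ℤ => (Q ^ n) (φ x)) hθ
    fun ε hε => by
      obtain ⟨δ, hδ, h⟩ := h ε hε
      refine ⟨δ, hδ, fun m n hmn => (dist_zpow_zpow_le_displacement m n (φ x)).trans_lt ?_⟩
      rw [dist_eq_norm, ← sub_smul] at hmn
      exact h _ hmn
  have hφη : φ = η ∘ α := by
    refine DenseRange.equalizer (hT x) hφ.continuous (hη.comp hα.continuous) (funext fun n => ?_)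
    simp only [Function.comp_apply]
    rw [hαn, hηn, semiconj_zpow hφ.equivariant]
  refine ⟨η, ⟨hη, ?_, fun z => ?_⟩, hφη⟩
  · exact Function.Surjective.of_comp (hφη ▸ hφ.surjective)
  · obtain ⟨y, rfl⟩ := hα.surjective z
    have h1 := congrFun hφη y
    have h2 := congrFun hφη (T y)
    simp only [Function.comp_apply] at h1 h2
    rw [← hα.equivariant, ← h2, ← h1, hφ.equivariant]

theorem exists_isEqRotation {X Y : Type u} [MetricSpace X] [CompactSpace X] [Nonempty X]
    [MetricSpace Y] [CompactSpace Y] [Nonempty Y] {T : X ≃ₜ X} {S : Y ≃ₜ Y}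
    (hT : IsMinimalSystem T) (hS : IsMinimalSystem S) :
    ∃ (Z : Type u) (_ : MetricSpace Z) (_ : CompactSpace Z) (_ : AddCommGroup Z)
      (_ : IsTopologicalAddGroup Z) (θ : Z) (α : X → Z) (β : Y → Z), IsEqRotation T S θ α β := by
  obtain ⟨x⟩ := ‹Nonempty X›
  obtain ⟨y⟩ := ‹Nonempty Y›
  have hx : DenseRange fun n : ℤ => (T ^ n) x := hT x
  obtain ⟨N, hNx, hNy, hN⟩ := exists_finest_isControlledBy hx fun n : ℤ => (S ^ n) y
  obtain ⟨Z, _, _, θ, hθ, hn⟩ := N.exists_completion_int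
  obtain ⟨α, hα, hαn⟩ := hNx.exists_isFactorMap hT hθ hn
  obtain ⟨β, hβ, hβn⟩ := hNy.exists_isFactorMap hS hθ hn
  -- The completion is compact only because it is a continuous image of `X`.
  have hZ : CompactSpace Z := hα.surjective.compactSpace hα.continuous
  refine ⟨Z, inferInstance, hZ, inferInstance, inferInstance, θ, α, β,
    isEquicontinuousSystem_addRight θ, hα, hβ, ?_⟩
  intro W _ _ Q φ ψ hQ hφ hψ
  have hdom := hN (displacement Q) (hφ.isControlledBy_displacement hT hQ x)
    (hψ.isControlledBy_displacement hS hQ y)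
  simp only [← hn] at hdom
  obtain ⟨η₁, h₁, h₁'⟩ := hα.exists_factorization hT hθ hαn hφ hdom
  obtain ⟨η₂, h₂, h₂'⟩ := hβ.exists_factorization hS hθ hβn hψ hdom
  exact ⟨η₁, η₂, h₁, h₂, h₁', h₂'⟩

end Existence

/-! ### The main theorem. -/

theorem mainTheorem3 {X Y : Type u} [MetricSpace X] [CompactSpace X] [Nonempty X]
    [MetricSpace Y] [CompactSpace Y] [Nonempty Y] (T : X ≃ₜ X) (S : Y ≃ₜ Y)
    (hT : IsMinimalSystem T) (hS : IsMinimalSystem S) :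
    (∃ (Z : Type u) (_ : MetricSpace Z) (_ : CompactSpace Z) (_ : AddCommGroup Z)
      (_ : IsTopologicalAddGroup Z) (θ : Z) (α : X → Z) (β : Y → Z), IsEqRotation T S θ α β) ∧
    ∀ (Z : Type u) [MetricSpace Z] [CompactSpace Z] [AddCommGroup Z] [IsTopologicalAddGroup Z]
      (θ : Z) (α : X → Z) (β : Y → Z), IsEqRotation T S θ α β →
      List.TFAE
        [StronglyQuasiDisjoint T S,
          ∃ z : Z, IsMinimalFibre T S α β z,
          ∃ Ω : Set Z, IsGδ Ω ∧ Dense Ω ∧ ∀ z ∈ Ω, IsMinimalFibre T S α β z] := by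
  refine ⟨exists_isEqRotation hT hS, ?_⟩
  intro Z _ _ _ _ θ α β h
  tfae_have 1 → 2 := by
    rintro ⟨Z', _, _, _, _, θ', α', β', h', Ω, hΩ, hmin⟩
    -- The Baire category theorem in the compact space `Z'`.
    obtain ⟨z, hz⟩ := (dense_of_mem_residual hΩ).nonempty
    exact h.exists_isMinimalFibre hT h' (hmin z hz)
  tfae_have 2 → 3 := by
    rintro ⟨z, hz⟩
    exact ⟨{w | IsMinimalFibre T S α β w},
      isGδ_setOf_isMinimalSubset_fibre (continuous_gammaMap h.left.continuous h.right.continuous)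
        (surjective_gammaMap h.left.surjective) (gammaMap_prodCongr h.left h.right),
      dense_setOf_isMinimalFibre hT h.left h.right hz, fun w hw => hw⟩
  tfae_have 3 → 1 := by
    rintro ⟨Ω, hG, hd, hmin⟩
    exact ⟨Z, _, ‹_›, _, ‹_›, θ, α, β, h, Ω, residual_of_dense_Gδ hG hd, hmin⟩
  tfae_finish
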